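/- **Setting.** Let $m,n\ge 1$ and let $G$ be a simple graph on $mn$ spins (qubits) in which every spin has at most three neighbours, and let $\theta_i\in\mathbb R$ be rotation angles. This covers the brickwork lattice (rows that are paths, with vertical bonds between adjacent rows: numbering from $0$, an even row is joined to the next row at columns $J\equiv 2,4 \pmod 8$ and an odd row at columns $J\equiv 6,0\pmod 8$, $J\ne0$), also when each of its sites is replaced by a horizontal chain of $s$ spins with the vertical bonds at the first spin of each chain (e.g. $s=7$): in all these lattices every spin has at most three neighbours. Let $|\psi\rangle=\prod_i R_z(\theta_i)\prod_{\{i,j\}\in E(G)}CZ_{ij}\,|+\rangle^{\otimes mn}$ with $R_z(\theta)=e^{-i\theta Z/2}$, let $\rho=|\psi\rangle\langle\psi|$ be the ideal output state, and let $$H'=\sum_i h_i,\qquad h_i=\tfrac12\Big(I-R_z(\theta_i)X_iR_z^\dagger(\theta_i)\prod_{j\sim i}Z_j\Big).$$ Let $q_x$ be the probability of the outcome $x$ when all spins of $\rho$ are measured in the $X$ basis. Let $\rho'$ be the (arbitrary) density matrix prepared in the laboratory, and let $q'_x$ be the outcome distribution of an imperfect $X$ measurement of all spins of $\rho'$. The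 measurement has *local imperfections of strength $\eta\ge 0$ per spin* if it is the ideal measurement preceded by a map $\Lambda$ of one of the following two forms, where "around $i$" means acting only on the spins within graph distance $R$ of $i$, for some arbitrary $R$: (a) $\Lambda$ is the composition, in any order, of one quantum channel $\Lambda_i$ around each spin $i$, with $\frac12\|\Lambda_i(\sigma)-\sigma\|_1\le\eta$ for all density matrices $\sigma$; or (b) $\Lambda=\mathcal I+\eta\sum_i\omega_i$ is a quantum channel, where each $\omega_i$ is a linear map acting around $i$ with $\|\omega_i(\sigma)\|_1\le 1$ for all density matrices $\sigma$. **Protocol.** Measure (ideally) each $h_i$ a number $M$ of times, each time on a fresh copy of $\rho'$. Let $E^*$ be the sum over $i$ of the sample means and put $F^*=1-E^*$. Accept if $F^*\ge\sqrt{1-\epsilon_d^2}+\epsilon'$. **Claim.** First, $$H'=\Big(\prod_iR_z(\theta_i)\Big)\Big(\sum_i\tfrac12\big(I-X_i\prod_{j\sim i}Z_j\big)\Big)\Big(\prod_jR_z^\dagger(\theta_j)\Big),$$ every $h_i$ acts on at most $4$ spins, the smallest eigenvalue of $H'$ is $0$, its eigenspace is spanned by the unit vector $|\psi\rangle$, and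 the smallest positive eigenvalue of $H'$ is exactly $1$. Second, there are absolute constants $c_d,c_f,c_m,c_e,C>0$ such that for all $m,n,G,\theta$ as above, all $0<\epsilon\le 2$, $r>0$, all integers $M\ge C\,m^2n^2r/\epsilon^4$ and all density matrices $\rho'$, the protocol with $\epsilon_d=c_d\epsilon$ and $\epsilon'=c_f\epsilon^2$ satisfies: 1. (certification) if the measurement imperfections are local with strength $\eta\le c_m\,\epsilon/(mn)$ per spin, then with probability at least $1-2^{-r}$ over the measurement record, $$\text{the protocol accepts}\ \Longrightarrow\ \sum_x|q_x-q'_x|\le\epsilon;$$ 2. (completeness) if $\operatorname{tr}(H'\rho')\le c_e\,\epsilon^2$ (in particular if $\rho'=\rho$), then the protocol accepts with probability at least $1-2^{-r}$. -/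

import Mathlib

open scoped ComplexOrder

noncomputable section

namespace BrickworkCert

/-- Operators on the space of spins one half indexed by `V`, written in the computational
(`Z`) basis, whose elements are the bit strings `V → Fin 2`. -/
abbrev Op (V : Type) : Type := Matrix (V → Fin 2) (V → Fin 2) ℂ

/-- The product operator `⨂ i, a i`. -/
def tensorOp {V : Type} [Fintype V] [DecidableEq V] (a : V → Matrix (Fin 2) (Fin 2) ℂ) : Op V :=
  Matrix.of fun x y => ∏ i, a i (x i) (y i)

/-- The Pauli matrix `X`. -/
def pauliX : Matrix (Fin 2) (Fin 2) ℂ := !![0, 1; 1, 0]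

/-- The Pauli matrix `Z`. -/
def pauliZ : Matrix (Fin 2) (Fin 2) ℂ := !![1, 0; 0, -1]

/-- The rotation `R_z(t) = exp (-i t Z / 2)`. -/
def rz (t : ℝ) : Matrix (Fin 2) (Fin 2) ℂ :=
  !![Complex.exp (-Complex.I * t / 2), 0; 0, Complex.exp (Complex.I * t / 2)]

/-- The layer `∏ i, R_z(θ i)` of single-spin rotations. -/
def rotLayer {V : Type} [Fintype V] [DecidableEq V] (θ : V → ℝ) : Op V := tensorOp fun i => rz (θ i)

open Classical in
/-- The product of the (diagonal, commuting) controlled-`Z` gates on all edges of `G`: an edge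
contributes the sign `-1` exactly when both of its ends are `1`. -/
def czLayer {V : Type} [Fintype V] [DecidableEq V] (G : SimpleGraph V) : Op V :=
  Matrix.diagonal fun x => ∏ e ∈ G.edgeFinset, if ∀ i ∈ e, x i = 1 then (-1 : ℂ) else 1

/-- The product state `|+⟩ ⊗ ⋯ ⊗ |+⟩`. -/
def plusState (V : Type) [Fintype V] [DecidableEq V] : (V → Fin 2) → ℂ :=
  fun _ => ((1 / Real.sqrt 2 : ℝ) : ℂ) ^ Fintype.card V

/-- The ideal output vector: the graph state of `G`, rotated by `R_z(θ i)` on each spin `i`. -/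
def idealVec {V : Type} [Fintype V] [DecidableEq V] (G : SimpleGraph V) (θ : V → ℝ) : (V → Fin 2) → ℂ :=
  (rotLayer θ).mulVec ((czLayer G).mulVec (plusState V))

/-- The ideal output state `ρ = |ψ⟩⟨ψ|`. -/
def idealState {V : Type} [Fintype V] [DecidableEq V] (G : SimpleGraph V) (θ : V → ℝ) : Op V :=
  Matrix.vecMulVec (idealVec G θ) (star (idealVec G θ))

/-- The stabilizer Hamiltonian `∑ i, (I - X_i ∏_{j ~ i} Z_j) / 2` of the graph state of `G`. -/
def graphHamiltonian {V : Type} [Fintype V] [DecidableEq V] (G : SimpleGraph V) : Op V :=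
  open Classical in
  ∑ i, (1 / 2 : ℂ) • (1 - tensorOp fun j =>
    if j = i then pauliX else if G.Adj i j then pauliZ else 1)

/-- The local term `(I - R_z(θ i) X_i R_z(θ i)† ∏_{j ~ i} Z_j) / 2`. -/
def localTerm {V : Type} [Fintype V] [DecidableEq V] (G : SimpleGraph V) (θ : V → ℝ) (i : V) : Op V :=
  open Classical in
  (1 / 2 : ℂ) • (1 - tensorOp fun j =>
    if j = i then rz (θ i) * pauliX * (rz (θ i)).conjTranspose
    else if G.Adj i j then pauliZ else 1)

/-- The rotated stabilizer Hamiltonian, as the sum of its local terms. -/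
def rotHamiltonian {V : Type} [Fintype V] [DecidableEq V] (G : SimpleGraph V) (θ : V → ℝ) : Op V :=
  ∑ i, localTerm G θ i

theorem tensorOp_isHermitian {V : Type} [Fintype V] [DecidableEq V] (a : V → Matrix (Fin 2) (Fin 2) ℂ)
    (ha : ∀ i, (a i).IsHermitian) : (tensorOp a).IsHermitian := by
  ext x y
  simp only [Matrix.conjTranspose_apply, tensorOp, Matrix.of_apply, star_prod]
  exact Finset.prod_congr rfl fun i _ => (ha i).apply _ _

theorem localTerm_isHermitian {V : Type} [Fintype V] [DecidableEq V] (G : SimpleGraph V) (θ : V → ℝ) (i : V) :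
    (localTerm G θ i).IsHermitian := by
  classical
  have hX : pauliX.IsHermitian := by
    ext a b; fin_cases a <;> fin_cases b <;> simp [pauliX]
  have hZ : pauliZ.IsHermitian := by
    ext a b; fin_cases a <;> fin_cases b <;> simp [pauliZ]
  unfold localTerm
  refine Matrix.IsHermitian.smul (Matrix.isHermitian_one.sub (tensorOp_isHermitian _ ?_)) ?_
  · intro j
    show Matrix.IsHermitian (ite _ _ _)
    split_ifs
    · exact Matrix.isHermitian_mul_mul_conjTranspose _ hX
    · exact hZ
    · exact Matrix.isHermitian_one
  · simp [isSelfAdjoint_iff]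

open Classical in
/-- The operator `A` acts only on the spins in `S`: it is `b ⊗ I` for an operator `b` on the
spins in `S` and the identity on the others. -/
def IsSupportedOn {V : Type} (S : Set V) (A : Op V) : Prop :=
  ∃ b : Matrix (S → Fin 2) (S → Fin 2) ℂ, ∀ x y : V → Fin 2,
    A x y = if ∀ j, j ∉ S → x j = y j then b (fun j => x j) (fun j => y j) else 0

/-- The operator `A` is `k`-local: it acts on at most `k` spins. -/
def IsLocal {V : Type} (k : ℕ) (A : Op V) : Prop :=
  ∃ S : Finset V, S.card ≤ k ∧ IsSupportedOn (S : Set V) A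

/-- `E` is the ground state energy of `H`, and `ψ` is a unit vector that spans the space of
ground states. -/
def IsUniqueGroundState {V : Type} [Fintype V] [DecidableEq V] (H : Op V) (E : ℝ) (ψ : (V → Fin 2) → ℂ) :
    Prop :=
  H.IsHermitian ∧ star ψ ⬝ᵥ ψ = 1 ∧
  (∀ E' : ℝ, Module.End.HasEigenvalue (Matrix.toLin' H) (E' : ℂ) → E ≤ E') ∧
  ∀ v : (V → Fin 2) → ℂ, H.mulVec v = (E : ℂ) • v ↔ ∃ c : ℂ, v = c • ψ

/-- The energy gap above the level `E` is `Δ`: the lowest eigenvalue of `H` that is greater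
than `E` exists and equals `E + Δ`. -/
def HasGap {V : Type} [Fintype V] [DecidableEq V] (H : Op V) (E Δ : ℝ) : Prop :=
  IsLeast {δ : ℝ | 0 < δ ∧ Module.End.HasEigenvalue (Matrix.toLin' H) ((E + δ : ℝ) : ℂ)} Δ

/-- Density matrices. -/
def IsDensity {V : Type} [Fintype V] [DecidableEq V] (σ : Op V) : Prop := σ.PosSemidef ∧ σ.trace = 1

/-- The expectation `tr (A σ)` of an observable. -/
def expectation {V : Type} [Fintype V] [DecidableEq V] (A σ : Op V) : ℝ := (A * σ).trace.re

/-- The trace norm `tr |A|`, as the sum of the singular values of `A`. -/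
def traceNorm {V : Type} [Fintype V] [DecidableEq V] (A : Op V) : ℝ :=
  ∑ k, Real.sqrt ((Matrix.isHermitian_conjTranspose_mul_self A).eigenvalues k)

/-- The trace distance `tr |σ - τ| / 2`. -/
def traceDist {V : Type} [Fintype V] [DecidableEq V] (σ τ : Op V) : ℝ := traceNorm (σ - τ) / 2

/-- The projection onto the eigenvector `|+⟩` (for `s = 0`) or `|-⟩` (for `s = 1`) of `X`. -/
def xProj (s : Fin 2) : Matrix (Fin 2) (Fin 2) ℂ :=
  (1 / 2 : ℂ) • (1 + (-1 : ℂ) ^ (s : ℕ) • pauliX)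

/-- The probability of the outcome `x` when every spin of the state `σ` is measured, without
imperfections, in the `X` basis. -/
def xProb {V : Type} [Fintype V] [DecidableEq V] (σ : Op V) (x : V → Fin 2) : ℝ :=
  expectation (tensorOp fun i => xProj (x i)) σ

/-- Quantum channels (completely positive and trace preserving), in Kraus form. -/
def IsChannel {V : Type} [Fintype V] [DecidableEq V] (Φ : Module.End ℂ (Op V)) : Prop :=
  ∃ (k : ℕ) (K : Fin k → Op V), ∑ a, (K a).conjTranspose * K a = 1 ∧
    ∀ A, Φ A = ∑ a, K a * A * (K a).conjTranspose

/-- The linear map `Φ` on operators acts only on the spins in `S`, that is, `Φ = Φ_S ⊗ id`: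
it commutes with left and right multiplication by operators that act outside `S`. -/
def ActsOn {V : Type} [Fintype V] [DecidableEq V] (S : Set V) (Φ : Module.End ℂ (Op V)) : Prop :=
  ∀ A B : Op V, IsSupportedOn Sᶜ B → Φ (B * A) = B * Φ A ∧ Φ (A * B) = Φ A * B

/-- The spins at graph distance at most `R` from the spin `i`. -/
def around {V : Type} (G : SimpleGraph V) (R : ℕ) (i : V) : Set V := {j | G.edist i j ≤ R}

/-- Local measurement imperfections of strength at most `η` per spin and of range `R`.
The imperfect measurement of all spins is the ideal one preceded by a map `Λ`, where `Λ` is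
either a product, in any order, of channels `Λ i` that act around the spins `i` and move each
state by at most `η`, or a channel of the first-order form `I + η ∑ i, ω i` with maps `ω i`
that act around the spins `i` and have norm at most `1`. -/
inductive IsImperfection {V : Type} [Fintype V] [DecidableEq V] (G : SimpleGraph V) (R : ℕ) (η : ℝ) :
    Module.End ℂ (Op V) → Prop
  | product (Λ : V → Module.End ℂ (Op V)) (l : List V) (hnodup : l.Nodup) (hmem : ∀ i, i ∈ l)
      (hchannel : ∀ i, IsChannel (Λ i)) (hlocal : ∀ i, ActsOn (around G R i) (Λ i))
      (hclose : ∀ i σ, IsDensity σ → traceDist (Λ i σ) σ ≤ η) :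
      IsImperfection G R η (l.map Λ).prod
  | firstOrder (ω : V → Module.End ℂ (Op V))
      (hlocal : ∀ i, ActsOn (around G R i) (ω i))
      (hnorm : ∀ i σ, IsDensity σ → traceNorm (ω i σ) ≤ 1)
      (hchannel : IsChannel (1 + (η : ℂ) • ∑ i, ω i)) :
      IsImperfection G R η (1 + (η : ℂ) • ∑ i, ω i)

/-- Born rule: the law of the outcome when the observable `A` is measured in the state `σ`. The
outcomes are the eigenvalues of `A`; each vector `v` of an orthonormal eigenbasis contributes
the probability `⟨v, σ v⟩` to its eigenvalue. -/
def outcomeLaw {V : Type} [Fintype V] [DecidableEq V] (A : Op V) (hA : A.IsHermitian) (σ : Op V) :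
    MeasureTheory.Measure ℝ :=
  ∑ k, ENNReal.ofReal
      (star (hA.eigenvectorBasis k).ofLp ⬝ᵥ σ.mulVec (hA.eigenvectorBasis k).ofLp).re •
    MeasureTheory.Measure.dirac (hA.eigenvalues k)

/-- The joint law of the measurement record of the certification protocol: every local term is
measured `M` times, each time on a fresh copy of `σ`. The entry `d (i, k)` of a record `d` is
the outcome of the `k`-th measurement of the local term at the spin `i`. -/
def recordLaw {V : Type} [Fintype V] [DecidableEq V] (G : SimpleGraph V) (θ : V → ℝ) (M : ℕ) (σ : Op V) :
    MeasureTheory.Measure (V × Fin M → ℝ) :=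
  MeasureTheory.Measure.pi fun p => outcomeLaw (localTerm G θ p.1) (localTerm_isHermitian G θ p.1) σ

/-- The estimate of the energy `tr (H σ)`: the sum over all local terms of the sample means. -/
def energyEstimate {V : Type} [Fintype V] [DecidableEq V] {M : ℕ} (d : V × Fin M → ℝ) : ℝ :=
  ∑ i, (∑ k, d (i, k)) / M

/-- The estimate of the fidelity with the ground state of a Hamiltonian with ground state energy
`0` and gap `1`. -/
def fidelityEstimate {V : Type} [Fintype V] [DecidableEq V] {M : ℕ} (d : V × Fin M → ℝ) : ℝ :=
  1 - energyEstimate d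

/-- The test of the certification protocol, with tolerance `εd` for the trace distance and
accuracy `ε'` for the fidelity. -/
def Accepts {V : Type} [Fintype V] [DecidableEq V] {M : ℕ} (εd ε' : ℝ) (d : V × Fin M → ℝ) : Prop :=
  Real.sqrt (1 - εd ^ 2) + ε' ≤ fidelityEstimate d

/-- The brickwork lattice on `m` rows and `n` columns, where each site of a row of the original
brickwork lattice is replaced by a chain of `s` spins; `s = 1` is the original lattice. Rows and
columns are numbered from `0`. Every row is a path. In the block with number `J`, the first spin
is joined to its neighbour in the row below if the row is even and `J` is `2` or `4` modulo `8`,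
or if the row is odd and `J` is `6` or `0` modulo `8`, with `J ≠ 0`. -/
def brickwork (s m n : ℕ) : SimpleGraph (Fin m × Fin n) :=
  SimpleGraph.fromRel fun u v =>
    (u.1 = v.1 ∧ (v.2 : ℕ) = u.2 + 1) ∨
    (u.2 = v.2 ∧ (v.1 : ℕ) = u.1 + 1 ∧ s ∣ (u.2 : ℕ) ∧
      ((Even (u.1 : ℕ) ∧ ((u.2 : ℕ) / s % 8 = 2 ∨ (u.2 : ℕ) / s % 8 = 4)) ∨
       (Odd (u.1 : ℕ) ∧ ((u.2 : ℕ) / s % 8 = 6 ∨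
          ((u.2 : ℕ) / s % 8 = 0 ∧ (u.2 : ℕ) / s ≠ 0)))))

end BrickworkCert

end

open BrickworkCert

noncomputable section

namespace BrickworkCert

open Matrix

/-! ### Algebra of product operators and single-spin gates. -/

section Tensor

variable {V : Type} [Fintype V] [DecidableEq V]

/-! One unitary, Hadamards followed by controlled-Z gates and rotations, diagonalizes all the local
terms at once: each becomes the projector onto bit 1 at its own spin (`localTerm_eq`). The
Hamiltonian is therefore unitarily equivalent to the diagonal operator counting ones. Its spectrum
is read off: level 0 belongs to the zero string alone, whose image is the ideal vector, and every
other string has weight at least 1.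

The same picture gives fidelity at least one minus energy (`one_sub_expectation_le_fidelity`), so an
energy estimate certifies fidelity. Fidelity F with a pure state bounds the l1 distance of ideal
outcome distributions by 2√(1 - F) (`sum_abs_sub_le_of_fidelity`). Imperfections add at most 2η per
spin, because outcome distributions contract the trace norm (`sum_norm_diag_conj_le`) and the errors
telescope.

The measured outcomes are independent and lie in [0, 1], with means summing to M times the energy.
Hoeffding's inequality thus controls both error events: an underestimated energy threatens
certification, an overestimated one completeness. -/

theorem tensorOp_mul (a b : V → Matrix (Fin 2) (Fin 2) ℂ) :
    tensorOp a * tensorOp b = tensorOp fun i => a i * b i := by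
  ext x y
  simp only [Matrix.mul_apply, tensorOp, Matrix.of_apply, ← Finset.prod_mul_distrib]
  rw [Finset.prod_univ_sum, Fintype.piFinset_univ]

theorem tensorOp_diagonal (d : V → Fin 2 → ℂ) :
    tensorOp (fun i => Matrix.diagonal (d i)) = Matrix.diagonal fun x => ∏ i, d i (x i) := by
  ext x y
  simp only [tensorOp, Matrix.of_apply, Matrix.diagonal_apply]
  split_ifs with h
  · subst h; simp
  · obtain ⟨i, hi⟩ := Function.ne_iff.1 h
    exact Finset.prod_eq_zero (Finset.mem_univ i) (if_neg hi)

theorem tensorOp_one : tensorOp (fun _ : V => 1) = 1 := by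
  have h := tensorOp_diagonal (V := V) fun _ _ => 1
  simpa using h

theorem tensorOp_conjTranspose (a : V → Matrix (Fin 2) (Fin 2) ℂ) :
    (tensorOp a)ᴴ = tensorOp fun i => (a i)ᴴ := by
  ext x y
  simp [tensorOp, Matrix.conjTranspose_apply]

theorem pauliZ_eq_diagonal : pauliZ = Matrix.diagonal fun s => if s = 1 then -1 else 1 := by
  ext a b; fin_cases a <;> fin_cases b <;> simp [pauliZ]

/-- The Hadamard matrix. -/
def had : Matrix (Fin 2) (Fin 2) ℂ := ((1 / Real.sqrt 2 : ℝ) : ℂ) • !![1, 1; 1, -1]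

theorem had_coeff_mul_self :
    ((1 / Real.sqrt 2 : ℝ) : ℂ) * ((1 / Real.sqrt 2 : ℝ) : ℂ) = 1 / 2 := by
  rw [← Complex.ofReal_mul, div_mul_div_comm, Real.mul_self_sqrt (by norm_num)]
  norm_num

/-- Pairing the two normalizations removes the square root, so the later 2×2 identities involve only
rational coefficients. -/
theorem had_mul_mul_had (A : Matrix (Fin 2) (Fin 2) ℂ) :
    had * A * had = (1 / 2 : ℂ) • (!![1, 1; 1, -1] * A * !![1, 1; 1, -1]) := by
  rw [had, Matrix.smul_mul, Matrix.smul_mul, Matrix.mul_smul, smul_smul, had_coeff_mul_self]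

theorem had_mul_had : had * had = 1 := by
  have h := had_mul_mul_had 1
  rw [mul_one, mul_one] at h
  rw [h]
  ext a b; fin_cases a <;> fin_cases b <;> norm_num [Matrix.mul_apply, Fin.sum_univ_two]

theorem had_conjTranspose : hadᴴ = had := by
  ext a b; fin_cases a <;> fin_cases b <;> simp [had]

theorem had_mul_pauliZ_mul_had : had * pauliZ * had = pauliX := by
  rw [had_mul_mul_had]
  ext a b; fin_cases a <;> fin_cases b <;>
    norm_num [pauliZ, pauliX, Matrix.mul_apply, Fin.sum_univ_two]

theorem xProj_eq (s : Fin 2) :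
    xProj s = had * Matrix.diagonal (fun t => if t = s then 1 else 0) * had := by
  rw [had_mul_mul_had]
  ext a b
  rw [Matrix.smul_apply, Matrix.mul_apply]
  simp only [Matrix.mul_diagonal, Fin.sum_univ_two]
  fin_cases s <;> fin_cases a <;> fin_cases b <;> simp [xProj, pauliX]

/-- The Hadamard transform of all spins. -/
def hadLayer (V : Type) [Fintype V] [DecidableEq V] : Op V := tensorOp fun _ => had

theorem hadLayer_mul_self : hadLayer V * hadLayer V = 1 := by
  simp only [hadLayer, tensorOp_mul, had_mul_had, tensorOp_one]

theorem hadLayer_conjTranspose : (hadLayer V)ᴴ = hadLayer V := by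
  simp only [hadLayer, tensorOp_conjTranspose, had_conjTranspose]

theorem hadLayer_conj (a : V → Matrix (Fin 2) (Fin 2) ℂ) :
    hadLayer V * tensorOp a * hadLayer V = tensorOp fun i => had * a i * had := by
  simp only [hadLayer, tensorOp_mul]

theorem plusState_eq : plusState V = hadLayer V *ᵥ Pi.single 0 1 := by
  ext x
  rw [Matrix.mulVec_single_one]
  simp only [plusState, hadLayer, tensorOp, Matrix.col_apply, Matrix.of_apply, Pi.zero_apply]
  rw [← Finset.card_univ, ← Finset.prod_const]
  refine Finset.prod_congr rfl fun i _ => ?_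
  generalize x i = s
  fin_cases s <;> simp [had]

theorem rz_mul_conjTranspose (t : ℝ) : rz t * (rz t)ᴴ = 1 := by
  ext a b
  fin_cases a <;> fin_cases b <;>
    simp [rz, Matrix.mul_apply, Fin.sum_univ_two, ← Complex.exp_conj, ← Complex.exp_add] <;>
    ring_nf <;> simp [Complex.conj_ofNat]; ring_nf; simp

theorem rz_mul_pauliZ_mul_conjTranspose (t : ℝ) : rz t * pauliZ * (rz t)ᴴ = pauliZ := by
  have h : rz t * pauliZ = pauliZ * rz t := by
    ext a b
    fin_cases a <;> fin_cases b <;> simp [rz, pauliZ, Matrix.mul_apply, Fin.sum_univ_two]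
  rw [h, mul_assoc, rz_mul_conjTranspose, mul_one]

theorem rotLayer_mul_conjTranspose (θ : V → ℝ) : rotLayer θ * (rotLayer θ)ᴴ = 1 := by
  simp only [rotLayer, tensorOp_conjTranspose, tensorOp_mul, rz_mul_conjTranspose, tensorOp_one]

theorem rotLayer_conj (θ : V → ℝ) (a : V → Matrix (Fin 2) (Fin 2) ℂ) :
    rotLayer θ * tensorOp a * (rotLayer θ)ᴴ = tensorOp fun i => rz (θ i) * a i * (rz (θ i))ᴴ := by
  simp only [rotLayer, tensorOp_conjTranspose, tensorOp_mul]

end Tensor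

/-! ### Simultaneous diagonalization of the local terms. -/

section Hamiltonian

variable {V : Type} [Fintype V] [DecidableEq V]

open Classical in
/-- The stabilizer generator `X_i ∏_{j ~ i} Z_j` of the graph state of `G`. -/
def stabilizer (G : SimpleGraph V) (i : V) : Op V :=
  tensorOp fun j => if j = i then pauliX else if G.Adj i j then pauliZ else 1

theorem rotLayer_stabilizer (G : SimpleGraph V) (θ : V → ℝ) (i : V) :
    localTerm G θ i =
      (1 / 2 : ℂ) • (1 - rotLayer θ * stabilizer G i * (rotLayer θ)ᴴ) := by
  classical
  rw [stabilizer, rotLayer_conj, localTerm]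
  congr 3
  funext j
  split_ifs with h₁ h₂
  · rw [h₁]
  · rw [rz_mul_pauliZ_mul_conjTranspose]
  · rw [mul_one, rz_mul_conjTranspose]

theorem rotHamiltonian_eq (G : SimpleGraph V) (θ : V → ℝ) :
    rotHamiltonian G θ = rotLayer θ * graphHamiltonian G * (rotLayer θ)ᴴ := by
  simp only [rotHamiltonian, graphHamiltonian, Finset.mul_sum, Finset.sum_mul]
  refine Finset.sum_congr rfl fun i _ => ?_
  rw [rotLayer_stabilizer, stabilizer, Matrix.mul_smul, Matrix.smul_mul, mul_sub, sub_mul, mul_one,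
    rotLayer_mul_conjTranspose]

open Classical in
/-- The sign that the controlled-`Z` gates give to a bit string. -/
def czSign (G : SimpleGraph V) (x : V → Fin 2) : ℂ :=
  ∏ e ∈ G.edgeFinset, if ∀ i ∈ e, x i = 1 then (-1 : ℂ) else 1

theorem czLayer_eq (G : SimpleGraph V) : czLayer G = Matrix.diagonal (czSign G) := rfl

theorem czSign_mul_self (G : SimpleGraph V) (x : V → Fin 2) : czSign G x * czSign G x = 1 := by
  rw [czSign, ← Finset.prod_mul_distrib]
  exact Finset.prod_eq_one fun e _ => by split_ifs <;> norm_num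

theorem star_czSign (G : SimpleGraph V) (x : V → Fin 2) : star (czSign G x) = czSign G x := by
  rw [czSign, star_prod]
  exact Finset.prod_congr rfl fun e _ => by split_ifs <;> simp

open Classical in
-- Edges avoiding `i` give both strings the same sign and cancel. On an edge from `i` to `j`,
-- exactly one of the strings has a 1 at `i`, so the two factors multiply to the sign of bit `j`.
theorem czSign_mul_flip (G : SimpleGraph V) {x y : V → Fin 2} {i : V} (hi : x i ≠ y i)
    (hj : ∀ j, j ≠ i → x j = y j) :
    czSign G x * czSign G y =
      ∏ j, if G.Adj i j then (if x j = 1 then (-1 : ℂ) else 1) else 1 := by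
  rw [czSign, czSign, ← Finset.prod_mul_distrib, ← Finset.prod_filter,
    ← Finset.prod_filter_mul_prod_filter_not G.edgeFinset (fun e => i ∈ e)]
  have hrest : ∏ e ∈ G.edgeFinset with ¬ i ∈ e,
      ((if ∀ j ∈ e, x j = 1 then (-1 : ℂ) else 1) * if ∀ j ∈ e, y j = 1 then (-1 : ℂ) else 1)
      = 1 := by
    refine Finset.prod_eq_one fun e he => ?_
    have hie := (Finset.mem_filter.1 he).2
    have : (∀ j ∈ e, x j = 1) ↔ ∀ j ∈ e, y j = 1 :=
      forall₂_congr fun j hje => by rw [hj j (by rintro rfl; exact hie hje)]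
    simp only [this]
    split_ifs <;> norm_num
  rw [hrest, mul_one]
  symm
  -- Neighbours of `i` correspond bijectively to edges through `i`.
  refine Finset.prod_nbij (fun j => s(i, j)) ?_ ?_ ?_ ?_
  · intro j hij
    simpa using hij
  · intro j _ k _ h
    exact Sym2.congr_right.1 h
  · intro e he
    obtain ⟨he, hie⟩ := Finset.mem_filter.1 (Finset.mem_coe.1 he)
    obtain ⟨j, rfl⟩ := Sym2.mem_iff_exists.1 hie
    exact ⟨j, by simpa using he, rfl⟩
  · intro j hij
    have hne : j ≠ i := fun h => G.irrefl (h ▸ (Finset.mem_filter.1 hij).2)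
    have hxy := hj j hne
    have h2 : ∀ s : Fin 2, s = 0 ∨ s = 1 := by decide
    simp only [Sym2.mem_iff, forall_eq_or_imp, forall_eq, ← hxy]
    rcases h2 (x i) with hx | hx <;> rcases h2 (y i) with hy | hy <;> simp_all

open Classical in
-- Conjugation by controlled-Z gates attaches a Z on every neighbour to `X_i`. Entrywise, both sides
-- vanish unless the strings differ exactly at `i`, where the product of the two signs is the
-- required Z factor.
theorem czLayer_conj (G : SimpleGraph V) (i : V) :
    czLayer G * tensorOp (fun j => if j = i then pauliX else 1) * czLayer G = stabilizer G i := by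
  have hst : stabilizer G i =
      tensorOp (fun j => Matrix.diagonal fun s =>
        if G.Adj i j then (if s = 1 then (-1 : ℂ) else 1) else 1) *
      tensorOp (fun j => if j = i then pauliX else 1) := by
    rw [tensorOp_mul, stabilizer]
    congr 1
    funext j
    split_ifs with h₁ h₂
    · subst h₁; exact absurd h₂ (G.irrefl)
    · simp
    · rw [pauliZ_eq_diagonal, mul_one]
    · simp
  rw [hst, tensorOp_diagonal, czLayer_eq]
  ext x y
  rw [Matrix.mul_diagonal, Matrix.diagonal_mul, Matrix.diagonal_mul]
  by_cases h : x i ≠ y i ∧ ∀ j, j ≠ i → x j = y j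
  · rw [← czSign_mul_flip G h.1 h.2]; ring
  · have h0 : tensorOp (fun j => if j = i then pauliX else 1) x y = 0 := by
      simp only [tensorOp, Matrix.of_apply]
      by_cases hi : x i = y i
      · refine Finset.prod_eq_zero (Finset.mem_univ i) ?_
        rw [if_pos rfl, hi]
        generalize y i = s
        fin_cases s <;> simp [pauliX]
      · obtain ⟨j, hji, hj⟩ : ∃ j, j ≠ i ∧ x j ≠ y j := by
          by_contra! hc; exact h ⟨hi, hc⟩
        refine Finset.prod_eq_zero (Finset.mem_univ j) ?_
        rw [if_neg hji, Matrix.one_apply_ne hj]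
    simp [h0]

theorem czLayer_conjTranspose (G : SimpleGraph V) : (czLayer G)ᴴ = czLayer G := by
  rw [czLayer_eq, Matrix.diagonal_conjTranspose]
  congr 1
  exact funext (star_czSign G)

theorem czLayer_mul_self (G : SimpleGraph V) : czLayer G * czLayer G = 1 := by
  simp only [czLayer_eq, Matrix.diagonal_mul_diagonal, czSign_mul_self, Matrix.diagonal_one]

/-- The unitary that maps the computational basis to the eigenbasis of the rotated Hamiltonian. -/
def eigenUnitary (G : SimpleGraph V) (θ : V → ℝ) : Op V := rotLayer θ * czLayer G * hadLayer V

theorem eigenUnitary_mul_conjTranspose (G : SimpleGraph V) (θ : V → ℝ) :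
    eigenUnitary G θ * (eigenUnitary G θ)ᴴ = 1 := by
  rw [eigenUnitary, Matrix.conjTranspose_mul, Matrix.conjTranspose_mul, hadLayer_conjTranspose,
    czLayer_conjTranspose]
  calc _ = rotLayer θ * (czLayer G * (hadLayer V * hadLayer V) * czLayer G) * (rotLayer θ)ᴴ := by
        simp only [mul_assoc]
    _ = 1 := by
      rw [hadLayer_mul_self, mul_one, czLayer_mul_self, mul_one, rotLayer_mul_conjTranspose]

theorem conjTranspose_mul_eigenUnitary (G : SimpleGraph V) (θ : V → ℝ) :
    (eigenUnitary G θ)ᴴ * eigenUnitary G θ = 1 :=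
  mul_eq_one_comm.1 (eigenUnitary_mul_conjTranspose G θ)

theorem idealVec_eq (G : SimpleGraph V) (θ : V → ℝ) :
    idealVec G θ = eigenUnitary G θ *ᵥ Pi.single 0 1 := by
  rw [idealVec, plusState_eq, eigenUnitary, Matrix.mulVec_mulVec, Matrix.mulVec_mulVec, mul_assoc]

/-- Start from (I - Z_i)/2, the projector onto bit 1: the Hadamards turn `Z_i` into `X_i`, the
controlled-Z gates turn that into the stabilizer, and the rotations give the local term. -/
theorem localTerm_eq (G : SimpleGraph V) (θ : V → ℝ) (i : V) :
    localTerm G θ i = eigenUnitary G θ *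
      Matrix.diagonal (fun x => if x i = 1 then (1 : ℂ) else 0) * (eigenUnitary G θ)ᴴ := by
  classical
  have hz : tensorOp (fun j => if j = i then pauliZ else 1) =
      Matrix.diagonal fun x : V → Fin 2 => if x i = 1 then (-1 : ℂ) else 1 := by
    have h := tensorOp_diagonal (V := V) fun j s =>
      if j = i then (if s = 1 then (-1 : ℂ) else 1) else 1
    convert h using 2
    · funext j
      split_ifs
      · exact pauliZ_eq_diagonal
      · simp
    · funext x
      rw [Finset.prod_ite_eq' Finset.univ i, if_pos (Finset.mem_univ i)]
  have hd : Matrix.diagonal (fun x : V → Fin 2 => if x i = 1 then (1 : ℂ) else 0) =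
      (1 / 2 : ℂ) • (1 - tensorOp (fun j => if j = i then pauliZ else 1)) := by
    rw [hz, ← Matrix.diagonal_one, Matrix.diagonal_sub, ← Matrix.diagonal_smul]
    congr 1
    funext x
    simp only [Pi.smul_apply, smul_eq_mul]
    split_ifs <;> norm_num
  have hx : hadLayer V * tensorOp (fun j => if j = i then pauliZ else 1) * hadLayer V =
      tensorOp (fun j => if j = i then pauliX else 1) := by
    rw [hadLayer_conj]
    congr 1
    funext j
    split_ifs
    · exact had_mul_pauliZ_mul_had
    · rw [mul_one, had_mul_had]
  rw [hd, Matrix.mul_smul, Matrix.smul_mul, mul_sub, sub_mul, mul_one,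
    eigenUnitary_mul_conjTranspose, rotLayer_stabilizer, ← czLayer_conj, ← hx, eigenUnitary,
    Matrix.conjTranspose_mul, Matrix.conjTranspose_mul, hadLayer_conjTranspose,
    czLayer_conjTranspose]
  simp only [mul_assoc]

/-- The number of ones in a bit string, as a real number. -/
def weight (x : V → Fin 2) : ℝ := ∑ i, if x i = 1 then 1 else 0

theorem rotHamiltonian_eq_conj (G : SimpleGraph V) (θ : V → ℝ) :
    rotHamiltonian G θ = eigenUnitary G θ *
      Matrix.diagonal (fun x => (weight x : ℂ)) * (eigenUnitary G θ)ᴴ := by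
  simp only [rotHamiltonian, localTerm_eq, ← Finset.mul_sum, ← Finset.sum_mul]
  congr 2
  ext x y
  rw [Matrix.sum_apply]
  by_cases h : x = y
  · subst h; simp [weight]
  · simp [h]

end Hamiltonian

/-! ### Eigenvectors and eigenvalues of a unitarily conjugated diagonal matrix. -/

section Spectrum

variable {n : Type*} [Fintype n] [DecidableEq n]

/-- In the rotated coordinates the eigenvalue equation decouples. This support criterion serves both
for the eigenvalues and for the exact ground space. -/
theorem conj_diagonal_mulVec_eq_smul_iff {U : Matrix n n ℂ} (hU : U * Uᴴ = 1) (d : n → ℂ) (c : ℂ)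
    (v : n → ℂ) :
    (U * Matrix.diagonal d * Uᴴ) *ᵥ v = c • v ↔
      ∀ k, d k ≠ c → (Uᴴ *ᵥ v) k = 0 := by
  have hU' : Uᴴ * U = 1 := mul_eq_one_comm.1 hU
  have h : (U * Matrix.diagonal d * Uᴴ) *ᵥ v = c • v ↔
      Matrix.diagonal d *ᵥ (Uᴴ *ᵥ v) = c • (Uᴴ *ᵥ v) := by
    constructor <;> intro h
    · have := congrArg (fun w => Uᴴ *ᵥ w) h
      simpa only [Matrix.mulVec_mulVec, ← mul_assoc, hU', one_mul, Matrix.mulVec_smul] using this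
    · have := congrArg (fun w => U *ᵥ w) h
      simpa only [Matrix.mulVec_mulVec, ← mul_assoc, hU, one_mulVec, Matrix.mulVec_smul] using this
  rw [h, funext_iff]
  refine forall_congr' fun k => ?_
  rw [Matrix.mulVec_diagonal, Pi.smul_apply, smul_eq_mul, mul_eq_mul_right_iff,
    or_iff_not_imp_left]

theorem hasEigenvalue_conj_diagonal_iff {U : Matrix n n ℂ} (hU : U * Uᴴ = 1) (d : n → ℂ) (c : ℂ) :
    Module.End.HasEigenvalue (Matrix.toLin' (U * Matrix.diagonal d * Uᴴ)) c ↔ ∃ k, d k = c := by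
  have hU' : Uᴴ * U = 1 := mul_eq_one_comm.1 hU
  constructor
  · intro h
    obtain ⟨v, hv⟩ := h.exists_hasEigenvector
    have hv1 := hv.apply_eq_smul
    rw [Matrix.toLin'_apply, conj_diagonal_mulVec_eq_smul_iff hU] at hv1
    by_contra! hc
    apply hv.2
    have h0 : Uᴴ *ᵥ v = 0 := funext fun k => hv1 k (hc k)
    have := congrArg (fun w => U *ᵥ w) h0
    simpa only [Matrix.mulVec_mulVec, hU, one_mulVec, Matrix.mulVec_zero] using this
  · rintro ⟨k, rfl⟩
    have hk : Uᴴ *ᵥ (U *ᵥ Pi.single k 1) = Pi.single k 1 := by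
      rw [Matrix.mulVec_mulVec, hU', one_mulVec]
    refine Module.End.hasEigenvalue_of_hasEigenvector (x := U *ᵥ Pi.single k 1)
      ⟨Module.End.mem_eigenspace_iff.2 ?_, fun h0 => ?_⟩
    · rw [Matrix.toLin'_apply, conj_diagonal_mulVec_eq_smul_iff hU, hk]
      intro j hj
      exact Pi.single_eq_of_ne (by rintro rfl; exact hj rfl) 1
    · rw [h0, Matrix.mulVec_zero] at hk
      simpa using congrFun hk k

end Spectrum

/-! ### Ground state, gap, and fidelity from energy. -/

section GroundState

variable {V : Type} [Fintype V]

theorem weight_zero : weight (0 : V → Fin 2) = 0 := by simp [weight]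

theorem one_le_weight {x : V → Fin 2} (hx : x ≠ 0) : 1 ≤ weight x := by
  obtain ⟨i, hi⟩ := Function.ne_iff.1 hx
  have h2 : ∀ s : Fin 2, s ≠ 0 → s = 1 := by decide
  calc (1 : ℝ) = if x i = 1 then 1 else 0 := by rw [if_pos (h2 _ hi)]
    _ ≤ weight x := Finset.single_le_sum (f := fun i => if x i = 1 then (1 : ℝ) else 0)
        (fun j _ => by split_ifs <;> norm_num) (Finset.mem_univ i)

theorem weight_nonneg (x : V → Fin 2) : 0 ≤ weight x :=
  Finset.sum_nonneg fun j _ => by split_ifs <;> norm_num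

variable [DecidableEq V]

theorem rotHamiltonian_isHermitian (G : SimpleGraph V) (θ : V → ℝ) :
    (rotHamiltonian G θ).IsHermitian := by
  rw [Matrix.IsHermitian, rotHamiltonian, Matrix.conjTranspose_sum]
  exact Finset.sum_congr rfl fun i _ => localTerm_isHermitian G θ i

theorem idealVec_normalized (G : SimpleGraph V) (θ : V → ℝ) :
    star (idealVec G θ) ⬝ᵥ idealVec G θ = 1 := by
  rw [idealVec_eq, Matrix.star_mulVec, ← Matrix.dotProduct_mulVec, Matrix.mulVec_mulVec,
    conjTranspose_mul_eigenUnitary, one_mulVec]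
  simp

theorem isUniqueGroundState_idealVec (G : SimpleGraph V) (θ : V → ℝ) :
    IsUniqueGroundState (rotHamiltonian G θ) 0 (idealVec G θ) := by
  have hU := eigenUnitary_mul_conjTranspose G θ
  refine ⟨rotHamiltonian_isHermitian G θ, idealVec_normalized G θ, fun E' hE => ?_, fun v => ?_⟩
  · rw [rotHamiltonian_eq_conj, hasEigenvalue_conj_diagonal_iff hU] at hE
    obtain ⟨x, hx⟩ := hE
    rw [← Complex.ofReal_inj.1 hx]
    exact weight_nonneg x
  · rw [rotHamiltonian_eq_conj, conj_diagonal_mulVec_eq_smul_iff hU, idealVec_eq]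
    constructor
    · intro h
      refine ⟨((eigenUnitary G θ)ᴴ *ᵥ v) 0, ?_⟩
      have hw : (eigenUnitary G θ)ᴴ *ᵥ v =
          ((eigenUnitary G θ)ᴴ *ᵥ v) 0 • Pi.single 0 1 := by
        ext x
        by_cases hx : x = 0
        · subst hx; simp
        · rw [h x (fun h0 => ?_)]
          · simp [hx]
          · linarith [one_le_weight hx, Complex.ofReal_inj.1 h0]
      have := congrArg (fun w => eigenUnitary G θ *ᵥ w) hw
      simpa only [Matrix.mulVec_mulVec, hU, one_mulVec, Matrix.mulVec_smul] using this
    · rintro ⟨c, rfl⟩ x hx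
      have hx0 : x ≠ 0 := by
        rintro rfl; exact hx (by rw [weight_zero])
      rw [Matrix.mulVec_smul, Matrix.mulVec_mulVec, conjTranspose_mul_eigenUnitary, one_mulVec]
      simp [hx0]

/-- A string with a single 1 attains the gap. Without spins there would be no excited level. -/
theorem hasGap_rotHamiltonian [Nonempty V] (G : SimpleGraph V) (θ : V → ℝ) :
    HasGap (rotHamiltonian G θ) 0 1 := by
  have hU := eigenUnitary_mul_conjTranspose G θ
  simp only [HasGap, zero_add, rotHamiltonian_eq_conj, hasEigenvalue_conj_diagonal_iff hU,
    Complex.ofReal_inj]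
  constructor
  · obtain ⟨i⟩ := ‹Nonempty V›
    refine ⟨one_pos, Pi.single i 1, ?_⟩
    simp [weight, Pi.single_apply]
  · rintro δ ⟨hδ, x, rfl⟩
    refine one_le_weight ?_
    rintro rfl
    exact hδ.ne' weight_zero

/-- The fidelity `⟨φ| σ |φ⟩` of a state with a pure state. -/
def fidelity (φ : (V → Fin 2) → ℂ) (σ : Op V) : ℝ := (star φ ⬝ᵥ σ *ᵥ φ).re

/-- In the eigenbasis the diagonal of the state is a probability distribution, the energy is its
mean weight, and the fidelity is its mass at the zero string. The claim is Markov's inequality for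
an integer-valued weight. -/
theorem one_sub_expectation_le_fidelity (G : SimpleGraph V) (θ : V → ℝ) {σ : Op V}
    (hσ : IsDensity σ) : 1 - expectation (rotHamiltonian G θ) σ ≤ fidelity (idealVec G θ) σ := by
  set U := eigenUnitary G θ with hUdef
  set τ := Uᴴ * σ * U with hτ
  have hτpos : τ.PosSemidef := hσ.1.conjTranspose_mul_mul_same U
  have hnonneg : ∀ x, 0 ≤ (τ x x).re := fun x => (Complex.le_def.1 (hτpos.diag_nonneg)).1
  have htr : ∑ x, (τ x x).re = 1 := by
    have : τ.trace = 1 := by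
      rw [hτ, Matrix.trace_mul_comm, ← mul_assoc, eigenUnitary_mul_conjTranspose, one_mul, hσ.2]
    rw [← Complex.re_sum]
    exact congrArg Complex.re this
  have hE : expectation (rotHamiltonian G θ) σ = ∑ x, weight x * (τ x x).re := by
    rw [expectation, rotHamiltonian_eq_conj, mul_assoc, mul_assoc, Matrix.trace_mul_comm, mul_assoc,
      ← hτ, Matrix.trace, Complex.re_sum]
    refine Finset.sum_congr rfl fun x _ => ?_
    rw [Matrix.diag_apply, Matrix.diagonal_mul, Complex.re_ofReal_mul]
  have hF : fidelity (idealVec G θ) σ = (τ 0 0).re := by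
    rw [fidelity, idealVec_eq, Matrix.star_mulVec, ← Matrix.dotProduct_mulVec, Matrix.mulVec_mulVec,
      Matrix.mulVec_mulVec, ← hUdef, ← hτ, Matrix.mulVec_single_one]
    simp
  rw [hE, hF, ← htr, ← Finset.sum_sub_distrib,
    ← Finset.add_sum_erase _ _ (Finset.mem_univ (0 : V → Fin 2)), weight_zero]
  have : ∑ x ∈ Finset.univ.erase 0, ((τ x x).re - weight x * (τ x x).re) ≤ 0 := by
    refine Finset.sum_nonpos fun x hx => ?_
    nlinarith [hnonneg x, one_le_weight (Finset.ne_of_mem_erase hx)]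
  linarith

end GroundState

/-! ### Supports of the local terms and degrees in the brickwork lattice. -/

section Locality

variable {V : Type}

theorem IsSupportedOn.sub {S : Set V} {A B : Op V} (hA : IsSupportedOn S A)
    (hB : IsSupportedOn S B) : IsSupportedOn S (A - B) := by
  obtain ⟨a, ha⟩ := hA
  obtain ⟨b, hb⟩ := hB
  refine ⟨a - b, fun x y => ?_⟩
  rw [Matrix.sub_apply, ha, hb]
  split_ifs <;> simp

theorem IsSupportedOn.smul {S : Set V} {A : Op V} (c : ℂ) (hA : IsSupportedOn S A) :
    IsSupportedOn S (c • A) := by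
  obtain ⟨a, ha⟩ := hA
  refine ⟨c • a, fun x y => ?_⟩
  rw [Matrix.smul_apply, ha]
  split_ifs <;> simp

variable [Fintype V] [DecidableEq V]

open Classical in
theorem isSupportedOn_tensorOp {S : Set V} {a : V → Matrix (Fin 2) (Fin 2) ℂ}
    (ha : ∀ i, i ∉ S → a i = 1) : IsSupportedOn S (tensorOp a) := by
  refine ⟨Matrix.of fun x y => ∏ i : S, a i (x i) (y i), fun x y => ?_⟩
  simp only [tensorOp, Matrix.of_apply]
  split_ifs with h
  · rw [← Fintype.prod_subtype_mul_prod_subtype (· ∈ S) fun i => a i (x i) (y i)]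
    have h1 : ∏ i : {i // i ∉ S}, a i (x i) (y i) = 1 :=
      Finset.prod_eq_one fun i _ => by rw [ha i i.2, h i i.2, Matrix.one_apply_eq]
    rw [h1, mul_one]
  · push Not at h
    obtain ⟨j, hj, hne⟩ := h
    exact Finset.prod_eq_zero (Finset.mem_univ j) (by rw [ha j hj, Matrix.one_apply_ne hne])

theorem isSupportedOn_one (S : Set V) : IsSupportedOn S (1 : Op V) :=
  tensorOp_one (V := V) ▸ isSupportedOn_tensorOp fun _ _ => rfl

theorem isLocal_localTerm (G : SimpleGraph V) (θ : V → ℝ) {i : V} {k : ℕ}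
    (hi : (G.neighborSet i).ncard ≤ k) : IsLocal (k + 1) (localTerm G θ i) := by
  classical
  refine ⟨insert i (G.neighborFinset i), (Finset.card_insert_le _ _).trans ?_, ?_⟩
  · rw [Set.ncard_eq_toFinset_card'] at hi
    simpa [SimpleGraph.neighborFinset] using hi
  · refine ((isSupportedOn_one _).sub (isSupportedOn_tensorOp fun j hj => ?_)).smul _
    simp only [Finset.coe_insert, Set.mem_insert_iff, Finset.mem_coe, SimpleGraph.mem_neighborFinset,
      not_or] at hj
    rw [if_neg hj.1, if_neg hj.2]

end Locality

/-- Besides left and right there is at most one vertical neighbour: bonds leaving even rows and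
bonds leaving odd rows downwards use disjoint residues of the block number, so a spin with a bond
below has none above. -/
theorem ncard_neighborSet_brickwork_le (s m n : ℕ) (i : Fin m × Fin n) :
    ((brickwork s m n).neighborSet i).ncard ≤ 3 := by
  obtain ⟨a, b⟩ := i
  set J := (b : ℕ) / s with hJ
  -- The only row that can hold a vertical neighbour. Truncated subtraction at the border, here and
  -- in `T`, merely adds a harmless candidate to the upper bound.
  set c : ℕ := if (Even (a : ℕ) ∧ (J % 8 = 2 ∨ J % 8 = 4)) ∨
    (Odd (a : ℕ) ∧ (J % 8 = 6 ∨ (J % 8 = 0 ∧ J ≠ 0))) then a + 1 else a - 1 with hc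
  let f : Fin m × Fin n → ℕ × ℕ := fun v => (v.1, v.2)
  have hf : Function.Injective f := fun u v h => by
    simp only [f, Prod.mk.injEq] at h
    exact Prod.ext (Fin.ext h.1) (Fin.ext h.2)
  let T : Finset (ℕ × ℕ) := {((a : ℕ), (b : ℕ) - 1), ((a : ℕ), (b : ℕ) + 1), (c, (b : ℕ))}
  have hsub : f '' (brickwork s m n).neighborSet (a, b) ⊆ T := by
    rintro _ ⟨⟨a', b'⟩, h, rfl⟩
    rw [SimpleGraph.mem_neighborSet, brickwork, SimpleGraph.fromRel_adj] at h
    simp only [T, f, Finset.coe_insert, Finset.coe_singleton, Set.mem_insert_iff,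
      Set.mem_singleton_iff, Prod.mk.injEq]
    obtain ⟨-, (⟨h1, h2⟩ | ⟨h1, h2, -, h3⟩) | (⟨h1, h2⟩ | ⟨h1, h2, -, h3⟩)⟩ := h
    · right; left
      simp only at h1 h2
      exact ⟨by rw [h1], h2⟩
    · right; right
      simp only at h1 h2 h3
      rw [← hJ] at h3
      rw [hc, if_pos h3, h2, h1]; exact ⟨rfl, rfl⟩
    · left
      simp only at h1 h2
      exact ⟨by rw [h1], by omega⟩
    · right; right
      simp only at h1 h2 h3
      rw [h1, ← hJ] at h3
      have hn : ¬ ((Even (a : ℕ) ∧ (J % 8 = 2 ∨ J % 8 = 4)) ∨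
          (Odd (a : ℕ) ∧ (J % 8 = 6 ∨ (J % 8 = 0 ∧ J ≠ 0)))) := by
        rw [h2]
        simp only [Nat.even_iff, Nat.odd_iff] at h3 ⊢
        omega
      rw [hc, if_neg hn, h1]
      exact ⟨by omega, rfl⟩
  rw [← Set.ncard_image_of_injective _ hf]
  refine (Set.ncard_le_ncard hsub T.finite_toSet).trans ?_
  rw [Set.ncard_coe_finset]
  exact Finset.card_le_three

/-! ### Diagonals against trace norm and fidelity. -/

section Norms

variable {n : Type*} [Fintype n]

theorem sum_norm_sq_col (M : Matrix n n ℂ) (k : n) :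
    ∑ x, ‖M x k‖ ^ 2 = ((Mᴴ * M) k k).re := by
  rw [Matrix.mul_apply, Complex.re_sum]
  refine Finset.sum_congr rfl fun x _ => ?_
  rw [Matrix.conjTranspose_apply, Complex.star_def, Complex.conj_mul', ← Complex.ofReal_pow,
    Complex.ofReal_re]

variable [DecidableEq n]

/-- Measurement contracts the trace norm. With `U` diagonalizing `Aᴴ * A`, the columns of `T * A *
U` have the singular values as lengths and those of `T * U` are unit vectors; Cauchy–Schwarz on each
pair of columns finishes. -/
theorem sum_norm_diag_conj_le (A : Matrix n n ℂ) {T : Matrix n n ℂ} (hT : Tᴴ * T = 1) :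
    ∑ x, ‖(T * A * Tᴴ) x x‖ ≤
      ∑ k, Real.sqrt ((Matrix.isHermitian_conjTranspose_mul_self A).eigenvalues k) := by
  set hA := Matrix.isHermitian_conjTranspose_mul_self A
  set U : Matrix n n ℂ := (hA.eigenvectorUnitary : Matrix n n ℂ) with hU
  have hU1 : U * Uᴴ = 1 := Matrix.mem_unitaryGroup_iff.1 hA.eigenvectorUnitary.2
  have hU2 : Uᴴ * U = 1 := mul_eq_one_comm.1 hU1
  have hdiag : Uᴴ * (Aᴴ * A) * U = Matrix.diagonal (fun k => (hA.eigenvalues k : ℂ)) := by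
    have h := hA.conjStarAlgAut_star_eigenvectorUnitary
    rw [Unitary.conjStarAlgAut_star_apply] at h
    exact h
  set M := T * A * U
  set N := T * U
  have hMM : Mᴴ * M = Matrix.diagonal (fun k => (hA.eigenvalues k : ℂ)) := by
    rw [← hdiag]
    calc Mᴴ * M = Uᴴ * (Aᴴ * (Tᴴ * T) * A) * U := by
          simp only [M, Matrix.conjTranspose_mul, mul_assoc]
      _ = _ := by rw [hT, mul_one]
  have hNN : Nᴴ * N = 1 := by
    calc Nᴴ * N = Uᴴ * (Tᴴ * T) * U := by
          simp only [N, Matrix.conjTranspose_mul, mul_assoc]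
      _ = 1 := by rw [hT, mul_one, hU2]
  have hMN : T * A * Tᴴ = M * Nᴴ := by
    calc T * A * Tᴴ = T * A * (U * Uᴴ) * Tᴴ := by rw [hU1, mul_one]
      _ = _ := by simp only [M, N, Matrix.conjTranspose_mul, mul_assoc]
  calc ∑ x, ‖(T * A * Tᴴ) x x‖ ≤ ∑ x, ∑ k, ‖M x k‖ * ‖N x k‖ := by
        refine Finset.sum_le_sum fun x _ => ?_
        rw [hMN, Matrix.mul_apply]
        refine (norm_sum_le _ _).trans_eq (Finset.sum_congr rfl fun k _ => ?_)
        rw [norm_mul, Matrix.conjTranspose_apply, norm_star]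
    _ = ∑ k, ∑ x, ‖M x k‖ * ‖N x k‖ := Finset.sum_comm
    _ ≤ ∑ k, Real.sqrt (∑ x, ‖M x k‖ ^ 2) * Real.sqrt (∑ x, ‖N x k‖ ^ 2) :=
        Finset.sum_le_sum fun k _ => Real.sum_mul_le_sqrt_mul_sqrt _ _ _
    _ = _ := by
        refine Finset.sum_congr rfl fun k _ => ?_
        rw [sum_norm_sq_col, sum_norm_sq_col, hMM, hNN]
        simp

omit [DecidableEq n] in
-- Fuchs–van de Graaf for a single measurement: fidelity is at most the squared Bhattacharyya
-- coefficient `B` of the two diagonals, and Cauchy–Schwarz on |a² - b²| = |a - b|(a + b) bounds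
-- their l1 distance by 2√(1 - B²).
theorem sum_abs_sub_le_of_fidelity {σ : Matrix n n ℂ} (hσ : σ.PosSemidef) (hσ1 : σ.trace = 1)
    {φ : n → ℂ} (hφ : star φ ⬝ᵥ φ = 1) :
    ∑ x, |‖φ x‖ ^ 2 - (σ x x).re| ≤ 2 * Real.sqrt (1 - (star φ ⬝ᵥ σ *ᵥ φ).re) := by
  obtain ⟨m, v, hv⟩ := Matrix.posSemidef_iff_eq_sum_vecMulVec.1 hσ
  -- A purification: σ is the Gram matrix of the vectors `w x`, so its diagonal consists of their
  -- squared lengths.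
  let w : n → EuclideanSpace ℂ (Fin m) := fun x => WithLp.toLp 2 fun k => v k x
  have hw : ∀ x, (σ x x).re = ‖w x‖ ^ 2 := fun x => by
    rw [EuclideanSpace.norm_sq_eq, hv, Matrix.sum_apply, Complex.re_sum]
    refine Finset.sum_congr rfl fun k _ => ?_
    rw [Matrix.vecMulVec_apply, Pi.star_apply, Complex.star_def, Complex.mul_conj',
      ← Complex.ofReal_pow, Complex.ofReal_re]
  have hw1 : ∑ x, ‖w x‖ ^ 2 = 1 := by
    simp only [← hw]
    rw [← Complex.re_sum]
    exact congrArg Complex.re hσ1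
  have hφ1 : ∑ x, ‖φ x‖ ^ 2 = 1 := by
    have h := congrArg Complex.re hφ
    rw [dotProduct, Complex.re_sum, Complex.one_re] at h
    rw [← h]
    refine Finset.sum_congr rfl fun x _ => ?_
    rw [Pi.star_apply, Complex.star_def, Complex.conj_mul', ← Complex.ofReal_pow,
      Complex.ofReal_re]
  have hF : (star φ ⬝ᵥ σ *ᵥ φ).re = ‖∑ x, star (φ x) • w x‖ ^ 2 := by
    rw [EuclideanSpace.norm_sq_eq, hv, Matrix.sum_mulVec, dotProduct_sum, Complex.re_sum]
    refine Finset.sum_congr rfl fun k _ => ?_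
    have hk : (∑ x, star (φ x) • w x) k = star φ ⬝ᵥ v k := by
      simp [w, dotProduct]
    have hst : star (v k) ⬝ᵥ φ = star (star φ ⬝ᵥ v k) := by
      rw [Matrix.star_dotProduct]
    rw [hk, Matrix.vecMulVec_mulVec, hst, dotProduct_smul, op_smul_eq_smul, smul_eq_mul,
      Complex.star_def, Complex.conj_mul', ← Complex.ofReal_pow, Complex.ofReal_re]
  set B := ∑ x, ‖φ x‖ * ‖w x‖ with hB
  have hFB : (star φ ⬝ᵥ σ *ᵥ φ).re ≤ B ^ 2 := by
    rw [hF]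
    refine pow_le_pow_left₀ (norm_nonneg _) ((norm_sum_le _ _).trans_eq ?_) 2
    exact Finset.sum_congr rfl fun x _ => by rw [norm_smul, norm_star]
  have hsub : ∑ x, |‖φ x‖ - ‖w x‖| ^ 2 = 2 - 2 * B := by
    calc _ = ∑ x, (‖φ x‖ ^ 2 + ‖w x‖ ^ 2 - 2 * (‖φ x‖ * ‖w x‖)) :=
          Finset.sum_congr rfl fun x _ => by rw [sq_abs]; ring
      _ = _ := by
        rw [Finset.sum_sub_distrib, Finset.sum_add_distrib, hφ1, hw1, ← Finset.mul_sum]; ring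
  have hadd : ∑ x, (‖φ x‖ + ‖w x‖) ^ 2 = 2 + 2 * B := by
    calc _ = ∑ x, (‖φ x‖ ^ 2 + ‖w x‖ ^ 2 + 2 * (‖φ x‖ * ‖w x‖)) :=
          Finset.sum_congr rfl fun x _ => by ring
      _ = _ := by
        rw [Finset.sum_add_distrib, Finset.sum_add_distrib, hφ1, hw1, ← Finset.mul_sum]; ring
  have hnn : 0 ≤ 2 - 2 * B := hsub ▸ Finset.sum_nonneg fun x _ => sq_nonneg _
  calc ∑ x, |‖φ x‖ ^ 2 - (σ x x).re| = ∑ x, |‖φ x‖ - ‖w x‖| * (‖φ x‖ + ‖w x‖) := by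
        refine Finset.sum_congr rfl fun x _ => ?_
        rw [hw, sq_sub_sq, abs_mul, abs_of_nonneg (by positivity), mul_comm]
    _ ≤ Real.sqrt (2 - 2 * B) * Real.sqrt (2 + 2 * B) := by
        rw [← hsub, ← hadd]
        exact Real.sum_mul_le_sqrt_mul_sqrt _ _ _
    _ = Real.sqrt (2 ^ 2 * (1 - B ^ 2)) := by
        rw [← Real.sqrt_mul hnn]; congr 1; ring
    _ = 2 * Real.sqrt (1 - B ^ 2) := by
        rw [Real.sqrt_mul (by norm_num), Real.sqrt_sq (by norm_num)]
    _ ≤ _ := by gcongr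

end Norms

/-! ### Ideal and imperfect X measurements. -/

section Measurement

variable {V : Type} [Fintype V] [DecidableEq V]

/-- Outcome probabilities are diagonal entries in the Hadamard basis, which brings in the diagonal
estimates above. -/
theorem xProb_eq (σ : Op V) (x : V → Fin 2) :
    xProb σ x = ((hadLayer V * σ * (hadLayer V)ᴴ) x x).re := by
  have h : tensorOp (fun i => xProj (x i)) =
      hadLayer V * Matrix.diagonal (fun y => if y = x then 1 else 0) * hadLayer V := by
    have hd : (fun y : V → Fin 2 => if y = x then (1 : ℂ) else 0) =
        fun y => ∏ i, if y i = x i then 1 else 0 := by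
      funext y
      simp [Finset.prod_ite_zero, funext_iff]
    rw [hd, ← tensorOp_diagonal fun i t => if t = x i then 1 else 0, hadLayer_conj]
    simp only [xProj_eq]
  rw [xProb, expectation, h, hadLayer_conjTranspose, mul_assoc, mul_assoc, Matrix.trace_mul_comm,
    mul_assoc, Matrix.trace, Complex.re_sum, Finset.sum_eq_single x]
  · simp [mul_assoc]
  · intro y _ hy
    simp [hy]
  · simp

theorem xProb_add (σ τ : Op V) (x : V → Fin 2) : xProb (σ + τ) x = xProb σ x + xProb τ x := by
  simp [xProb_eq, mul_add, add_mul]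

theorem xProb_sub (σ τ : Op V) (x : V → Fin 2) : xProb (σ - τ) x = xProb σ x - xProb τ x := by
  simp [xProb_eq, mul_sub, sub_mul]

theorem xProb_sum {ι : Type*} (s : Finset ι) (σ : ι → Op V) (x : V → Fin 2) :
    xProb (∑ i ∈ s, σ i) x = ∑ i ∈ s, xProb (σ i) x := by
  simp [xProb_eq, Finset.mul_sum, Finset.sum_mul, Matrix.sum_apply]

theorem xProb_real_smul (c : ℝ) (σ : Op V) (x : V → Fin 2) :
    xProb ((c : ℂ) • σ) x = c * xProb σ x := by
  simp [xProb_eq]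

theorem sum_abs_xProb_le_traceNorm (A : Op V) : ∑ x, |xProb A x| ≤ traceNorm A := by
  refine le_trans (Finset.sum_le_sum fun x _ => ?_)
    (sum_norm_diag_conj_le A (T := hadLayer V)
      (by rw [hadLayer_conjTranspose, hadLayer_mul_self]))
  rw [xProb_eq]
  exact Complex.abs_re_le_norm _

theorem sum_abs_xProb_pure_sub_le {φ : (V → Fin 2) → ℂ} (hφ : star φ ⬝ᵥ φ = 1) {σ : Op V}
    (hσ : IsDensity σ) :
    ∑ x, |xProb (Matrix.vecMulVec φ (star φ)) x - xProb σ x| ≤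
      2 * Real.sqrt (1 - fidelity φ σ) := by
  set T := hadLayer V with hTdef
  have hT : Tᴴ * T = 1 := by rw [hTdef, hadLayer_conjTranspose, hadLayer_mul_self]
  have h := sum_abs_sub_le_of_fidelity (σ := T * σ * Tᴴ) (φ := T *ᵥ φ)
    (hσ.1.mul_mul_conjTranspose_same T)
    (by rw [Matrix.trace_mul_comm, ← mul_assoc, hT, one_mul, hσ.2])
    (by rw [Matrix.star_mulVec, ← Matrix.dotProduct_mulVec, Matrix.mulVec_mulVec, hT, one_mulVec,
      hφ])
  have hF : star (T *ᵥ φ) ⬝ᵥ (T * σ * Tᴴ) *ᵥ (T *ᵥ φ) = star φ ⬝ᵥ σ *ᵥ φ := by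
    rw [Matrix.star_mulVec, ← Matrix.dotProduct_mulVec, Matrix.mulVec_mulVec, Matrix.mulVec_mulVec]
    congr 2
    calc Tᴴ * (T * σ * Tᴴ) * T = (Tᴴ * T) * σ * (Tᴴ * T) := by simp only [mul_assoc]
      _ = σ := by rw [hT, one_mul, mul_one]
  rw [hF] at h
  refine le_of_eq_of_le (Finset.sum_congr rfl fun x _ => ?_) h
  rw [xProb_eq, xProb_eq, ← hTdef, Matrix.mul_vecMulVec, Matrix.vecMulVec_mul,
    ← Matrix.star_mulVec, Matrix.vecMulVec_apply, Pi.star_apply, Complex.star_def,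
    Complex.mul_conj', ← Complex.ofReal_pow, Complex.ofReal_re]

theorem IsChannel.isDensity {Φ : Module.End ℂ (Op V)} (hΦ : IsChannel Φ) {σ : Op V}
    (hσ : IsDensity σ) : IsDensity (Φ σ) := by
  obtain ⟨k, K, hK, h⟩ := hΦ
  rw [h]
  constructor
  · exact Matrix.posSemidef_sum _ fun a _ => hσ.1.mul_mul_conjTranspose_same (K a)
  · rw [Matrix.trace_sum]
    calc ∑ a, (K a * σ * (K a)ᴴ).trace = ∑ a, ((K a)ᴴ * K a * σ).trace :=
          Finset.sum_congr rfl fun a _ => by rw [Matrix.trace_mul_comm, mul_assoc]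
      _ = 1 := by rw [← Matrix.trace_sum, ← Finset.sum_mul, hK, one_mul, hσ.2]

theorem isDensity_list_prod {Λ : V → Module.End ℂ (Op V)} (hΛ : ∀ i, IsChannel (Λ i)) (l : List V)
    {σ : Op V} (hσ : IsDensity σ) : IsDensity ((l.map Λ).prod σ) := by
  induction l with
  | nil => simpa using hσ
  | cons i l ih =>
    rw [List.map_cons, List.prod_cons, Module.End.mul_apply]
    exact (hΛ i).isDensity ih

/-- Telescoping: every channel acts on the output of the earlier ones, which is still a density
matrix, and so costs at most 2η in trace norm. -/
theorem sum_abs_xProb_list_prod_sub_le {Λ : V → Module.End ℂ (Op V)} {η : ℝ}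
    (hΛ : ∀ i, IsChannel (Λ i)) (hη : ∀ i σ, IsDensity σ → traceDist (Λ i σ) σ ≤ η) (l : List V)
    {σ : Op V} (hσ : IsDensity σ) :
    ∑ x, |xProb ((l.map Λ).prod σ) x - xProb σ x| ≤ 2 * η * l.length := by
  induction l with
  | nil => simp
  | cons i l ih =>
    rw [List.map_cons, List.prod_cons, Module.End.mul_apply]
    set τ := (l.map Λ).prod σ with hτ
    have h1 : ∑ x, |xProb (Λ i τ) x - xProb τ x| ≤ 2 * η := by
      have h := sum_abs_xProb_le_traceNorm (Λ i τ - τ)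
      have h' := hη i τ (isDensity_list_prod hΛ l hσ)
      rw [traceDist] at h'
      simp only [xProb_sub] at h
      linarith
    have h2 : ∑ x, |xProb (Λ i τ) x - xProb σ x| ≤
        ∑ x, |xProb (Λ i τ) x - xProb τ x| + ∑ x, |xProb τ x - xProb σ x| := by
      rw [← Finset.sum_add_distrib]
      exact Finset.sum_le_sum fun x _ => abs_sub_le _ _ _
    rw [List.length_cons, Nat.cast_succ]
    linarith

theorem IsImperfection.sum_abs_xProb_sub_le {G : SimpleGraph V} {R : ℕ} {η : ℝ}
    {Λ : Module.End ℂ (Op V)} (hη : 0 ≤ η) (hΛ : IsImperfection G R η Λ) {σ : Op V}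
    (hσ : IsDensity σ) :
    ∑ x, |xProb (Λ σ) x - xProb σ x| ≤ 2 * η * Fintype.card V := by
  cases hΛ with
  | product Λ l hnodup hmem hchannel hlocal hclose =>
    refine (sum_abs_xProb_list_prod_sub_le hchannel hclose l hσ).trans ?_
    gcongr
    exact hnodup.length_le_card
  | firstOrder ω hlocal hnorm hchannel =>
    have hx : ∀ x, xProb ((1 + (η : ℂ) • ∑ i, ω i : Module.End ℂ (Op V)) σ) x - xProb σ x =
        η * ∑ i, xProb (ω i σ) x := fun x => by
      rw [LinearMap.add_apply, xProb_add, LinearMap.smul_apply, xProb_real_smul,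
        LinearMap.sum_apply, xProb_sum, Module.End.one_apply, add_sub_cancel_left]
    calc _ = ∑ x, η * |∑ i, xProb (ω i σ) x| :=
          Finset.sum_congr rfl fun x _ => by rw [hx, abs_mul, abs_of_nonneg hη]
      _ ≤ ∑ x, η * ∑ i, |xProb (ω i σ) x| := by
          gcongr; exact Finset.abs_sum_le_sum_abs _ _
      _ = η * ∑ i, ∑ x, |xProb (ω i σ) x| := by rw [← Finset.mul_sum, Finset.sum_comm]
      _ ≤ η * ∑ _i : V, 1 := by
          gcongr with i
          exact (sum_abs_xProb_le_traceNorm _).trans (hnorm i σ hσ)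
      _ = η * Fintype.card V := by simp
      -- The first-order form needs no factor 2; it is added to share the bound of the product form.
      _ ≤ 2 * η * Fintype.card V := by
          gcongr; linarith

end Measurement

open MeasureTheory ProbabilityTheory

/-! ### Hoeffding bounds for product measures. -/

section Hoeffding

variable {ι : Type*} [Fintype ι] {μ : ι → Measure ℝ} [∀ i, IsProbabilityMeasure (μ i)]

/-- Coordinates are independent under the product measure. The variance proxy 1/4 is the one of
Hoeffding's lemma for an interval of length 1, written as that lemma provides it. -/
theorem pi_real_sum_ge_le_of_hasSubgaussianMGF {X : ι → ℝ → ℝ}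
    (hX : ∀ i, HasSubgaussianMGF (X i) ((‖(1 : ℝ) - 0‖₊ / 2) ^ 2) (μ i)) {t : ℝ} (ht : 0 ≤ t) :
    (Measure.pi μ).real {d | t ≤ ∑ i, X i (d i)} ≤ Real.exp (-2 * t ^ 2 / Fintype.card ι) := by
  have hindep : iIndepFun (fun i (d : ι → ℝ) => X i (d i)) (Measure.pi μ) :=
    iIndepFun_pi fun i => (hX i).aemeasurable
  have hsub : ∀ i ∈ Finset.univ, HasSubgaussianMGF (fun d : ι → ℝ => X i (d i))
      ((‖(1 : ℝ) - 0‖₊ / 2) ^ 2) (Measure.pi μ) := fun i _ => by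
    refine HasSubgaussianMGF.of_map (Y := fun d : ι → ℝ => d i) (measurable_pi_apply i).aemeasurable
      ?_
    rw [(measurePreserving_eval μ i).map_eq]
    exact hX i
  refine (HasSubgaussianMGF.measure_sum_ge_le_of_iIndepFun hindep hsub ht).trans_eq ?_
  congr 1
  simp only [sub_zero, nnnorm_one, Finset.sum_const, Finset.card_univ, nsmul_eq_mul]
  push_cast
  rw [show (2 : ℝ) * (Fintype.card ι * (1 / 2) ^ 2) = Fintype.card ι / 2 by ring, div_div_eq_mul_div]
  ring

theorem pi_real_sum_sub_integral_ge_le (hμ : ∀ i, ∀ᵐ a ∂μ i, a ∈ Set.Icc (0 : ℝ) 1) {t : ℝ}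
    (ht : 0 ≤ t) :
    (Measure.pi μ).real {d | t ≤ ∑ i, (d i - ∫ a, a ∂μ i)} ≤
      Real.exp (-2 * t ^ 2 / Fintype.card ι) :=
  pi_real_sum_ge_le_of_hasSubgaussianMGF (X := fun i a => a - ∫ b, b ∂μ i)
    (fun i => hasSubgaussianMGF_of_mem_Icc aemeasurable_id (hμ i)) ht

theorem pi_real_sum_integral_sub_ge_le (hμ : ∀ i, ∀ᵐ a ∂μ i, a ∈ Set.Icc (0 : ℝ) 1) {t : ℝ}
    (ht : 0 ≤ t) :
    (Measure.pi μ).real {d | t ≤ ∑ i, ((∫ a, a ∂μ i) - d i)} ≤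
      Real.exp (-2 * t ^ 2 / Fintype.card ι) :=
  pi_real_sum_ge_le_of_hasSubgaussianMGF (X := fun i a => (∫ b, b ∂μ i) - a)
    (fun i => ((hasSubgaussianMGF_of_mem_Icc aemeasurable_id (hμ i)).neg).congr
      (by filter_upwards with a; simp)) ht

end Hoeffding

/-! ### Born's rule: total mass, mean and range of the outcome law. -/

section BornRule

variable {V : Type} [Fintype V] [DecidableEq V] {A σ : Op V}

/-- The Born probability of the `k`-th vector of the eigenbasis of `A`. -/
def bornWeight (hA : A.IsHermitian) (σ : Op V) (k : V → Fin 2) : ℝ :=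
  (star (hA.eigenvectorBasis k).ofLp ⬝ᵥ σ *ᵥ (hA.eigenvectorBasis k).ofLp).re

theorem outcomeLaw_eq (hA : A.IsHermitian) (σ : Op V) : outcomeLaw A hA σ =
    ∑ k, ENNReal.ofReal (bornWeight hA σ k) • Measure.dirac (hA.eigenvalues k) := rfl

theorem bornWeight_nonneg (hA : A.IsHermitian) (hσ : IsDensity σ) (k : V → Fin 2) :
    0 ≤ bornWeight hA σ k :=
  (Complex.le_def.1 (hσ.1.dotProduct_mulVec_nonneg _)).1

theorem bornWeight_eq (hA : A.IsHermitian) (σ : Op V) (k : V → Fin 2) :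
    bornWeight hA σ k = (((hA.eigenvectorUnitary : Op V)ᴴ * σ * (hA.eigenvectorUnitary : Op V))
      k k).re := by
  rw [bornWeight, ← hA.eigenvectorUnitary_mulVec, Matrix.star_mulVec, ← Matrix.dotProduct_mulVec,
    Matrix.mulVec_mulVec, Matrix.mulVec_mulVec, Matrix.mulVec_single_one]
  simp [mul_assoc]

theorem sum_eigenvalues_mul_bornWeight (hA : A.IsHermitian) (σ : Op V) :
    ∑ k, hA.eigenvalues k * bornWeight hA σ k = expectation A σ := by
  set U : Op V := (hA.eigenvectorUnitary : Op V) with hU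
  have h : A = U * Matrix.diagonal (fun k => (hA.eigenvalues k : ℂ)) * Uᴴ := by
    have h := hA.spectral_theorem
    rw [Unitary.conjStarAlgAut_apply] at h
    exact h
  have hE : expectation A σ =
      (Matrix.diagonal (fun k => (hA.eigenvalues k : ℂ)) * (Uᴴ * σ * U)).trace.re := by
    rw [expectation]
    nth_rw 1 [h]
    rw [mul_assoc, mul_assoc, Matrix.trace_mul_comm, mul_assoc]
  rw [hE, Matrix.trace, Complex.re_sum]
  refine Finset.sum_congr rfl fun k _ => ?_
  rw [Matrix.diag_apply, Matrix.diagonal_mul, Complex.re_ofReal_mul, bornWeight_eq]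

theorem sum_bornWeight (hA : A.IsHermitian) (hσ : IsDensity σ) : ∑ k, bornWeight hA σ k = 1 := by
  set U : Op V := (hA.eigenvectorUnitary : Op V) with hU
  have hU1 : U * Uᴴ = 1 := Matrix.mem_unitaryGroup_iff.1 hA.eigenvectorUnitary.2
  have h : (Uᴴ * σ * U).trace = 1 := by
    rw [Matrix.trace_mul_comm, ← mul_assoc, hU1, one_mul, hσ.2]
  simp only [bornWeight_eq]
  rw [← Complex.re_sum]
  exact congrArg Complex.re h

theorem isProbabilityMeasure_outcomeLaw (hA : A.IsHermitian) (hσ : IsDensity σ) :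
    IsProbabilityMeasure (outcomeLaw A hA σ) := by
  constructor
  rw [outcomeLaw_eq]
  simp only [Measure.coe_finsetSum, Finset.sum_apply, Measure.smul_apply, measure_univ,
    smul_eq_mul, mul_one]
  rw [← ENNReal.ofReal_sum_of_nonneg fun k _ => bornWeight_nonneg hA hσ k, sum_bornWeight hA hσ,
    ENNReal.ofReal_one]

theorem integral_outcomeLaw (hA : A.IsHermitian) (hσ : IsDensity σ) :
    ∫ a, a ∂outcomeLaw A hA σ = expectation A σ := by
  rw [outcomeLaw_eq, integral_finsetSum_measure, ← sum_eigenvalues_mul_bornWeight hA]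
  · refine Finset.sum_congr rfl fun k _ => ?_
    rw [integral_smul_measure, integral_dirac, ENNReal.toReal_ofReal (bornWeight_nonneg hA hσ k),
      smul_eq_mul, mul_comm]
  · intro k _
    exact (integrable_dirac (by simp)).smul_measure ENNReal.ofReal_ne_top

theorem ae_outcomeLaw_mem {s : Set ℝ} (hs : MeasurableSet s) (hA : A.IsHermitian)
    (h : ∀ k, hA.eigenvalues k ∈ s) : ∀ᵐ a ∂outcomeLaw A hA σ, a ∈ s := by
  rw [ae_iff, outcomeLaw_eq]
  simp only [Measure.coe_finsetSum, Finset.sum_apply, Measure.smul_apply, smul_eq_mul]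
  refine Finset.sum_eq_zero fun k _ => ?_
  change _ * Measure.dirac _ sᶜ = 0
  rw [Measure.dirac_apply' _ hs.compl, Set.indicator_of_notMem (Set.notMem_compl_iff.2 (h k)), mul_zero]

end BornRule

/-! ### Concentration of the energy estimate and the two guarantees. -/

section Record

variable {V : Type} [Fintype V] [DecidableEq V]

theorem eigenvalues_localTerm_mem_Icc (G : SimpleGraph V) (θ : V → ℝ) (i : V) (k : V → Fin 2) :
    (localTerm_isHermitian G θ i).eigenvalues k ∈ Set.Icc (0 : ℝ) 1 := by
  set hA := localTerm_isHermitian G θ i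
  obtain ⟨c, hc⟩ : ∃ c, hA.eigenvalues k = c := ⟨_, rfl⟩
  rw [hc]
  have hev : Module.End.HasEigenvalue (Matrix.toLin' (localTerm G θ i)) (c : ℂ) := by
    refine Module.End.hasEigenvalue_of_hasEigenvector (x := (hA.eigenvectorBasis k).ofLp)
      ⟨Module.End.mem_eigenspace_iff.2 ?_, fun h0 => ?_⟩
    · rw [Matrix.toLin'_apply, hA.mulVec_eigenvectorBasis, hc]
      rfl
    · exact hA.eigenvectorBasis.orthonormal.ne_zero k (WithLp.ofLp_injective 2 h0)
  rw [localTerm_eq, hasEigenvalue_conj_diagonal_iff (eigenUnitary_mul_conjTranspose G θ)] at hev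
  obtain ⟨x, hx⟩ := hev
  split_ifs at hx
  · rw [← Complex.ofReal_one, Complex.ofReal_inj] at hx
    rw [← hx]; norm_num
  · rw [← Complex.ofReal_zero, Complex.ofReal_inj] at hx
    rw [← hx]; norm_num

variable {G : SimpleGraph V} {θ : V → ℝ} {M : ℕ} {σ : Op V}

theorem isProbabilityMeasure_recordLaw (hσ : IsDensity σ) :
    IsProbabilityMeasure (recordLaw G θ M σ) := by
  have := fun p : V × Fin M =>
    isProbabilityMeasure_outcomeLaw (localTerm_isHermitian G θ p.1) hσ
  unfold recordLaw
  infer_instance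

theorem sum_record_sub (hM : 0 < M) (hσ : IsDensity σ) (d : V × Fin M → ℝ) :
    ∑ p, (d p - ∫ a, a ∂outcomeLaw (localTerm G θ p.1) (localTerm_isHermitian G θ p.1) σ) =
      M * (energyEstimate d - expectation (rotHamiltonian G θ) σ) := by
  have hM' : (M : ℝ) ≠ 0 := by positivity
  have hE : expectation (rotHamiltonian G θ) σ = ∑ i, expectation (localTerm G θ i) σ := by
    simp [expectation, rotHamiltonian, Finset.sum_mul, Matrix.trace_sum]
  simp only [integral_outcomeLaw _ hσ, Fintype.sum_prod_type, Finset.sum_sub_distrib,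
    energyEstimate, hE, mul_sub, Finset.mul_sum, mul_div_cancel₀ _ hM']
  simp

theorem sum_sub_record (hM : 0 < M) (hσ : IsDensity σ) (d : V × Fin M → ℝ) :
    ∑ p : V × Fin M, ((∫ a, a ∂outcomeLaw (localTerm G θ p.1) (localTerm_isHermitian G θ p.1) σ) - d p) =
      M * (expectation (rotHamiltonian G θ) σ - energyEstimate d) := by
  have h := sum_record_sub (G := G) (θ := θ) hM hσ d
  rw [Finset.sum_sub_distrib] at h ⊢
  linarith

/-- An error `t` in the estimate is a deviation `M * t` of a sum with `M` terms per spin, so one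
factor `M` survives in Hoeffding's exponent. -/
theorem recordLaw_real_energyEstimate_sub_ge_le (hM : 0 < M) (hσ : IsDensity σ) {t : ℝ}
    (ht : 0 ≤ t) :
    (recordLaw G θ M σ).real {d | t ≤ energyEstimate d - expectation (rotHamiltonian G θ) σ} ≤
      Real.exp (-2 * M * t ^ 2 / Fintype.card V) := by
  have := fun p : V × Fin M =>
    isProbabilityMeasure_outcomeLaw (localTerm_isHermitian G θ p.1) hσ
  have hM' : (0 : ℝ) < M := by exact_mod_cast hM
  have h := pi_real_sum_sub_integral_ge_le
    (μ := fun p : V × Fin M =>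
      outcomeLaw (localTerm G θ p.1) (localTerm_isHermitian G θ p.1) σ)
    (fun p => ae_outcomeLaw_mem measurableSet_Icc _ (eigenvalues_localTerm_mem_Icc G θ p.1))
    (t := M * t) (by positivity)
  simp only [sum_record_sub hM hσ, mul_le_mul_iff_right₀ hM'] at h
  refine h.trans_eq (congrArg Real.exp ?_)
  rw [Fintype.card_prod, Fintype.card_fin, Nat.cast_mul]
  rw [show -2 * ((M : ℝ) * t) ^ 2 = (-2 * M * t ^ 2) * M by ring, mul_div_mul_right _ _ hM'.ne']

theorem recordLaw_real_sub_energyEstimate_ge_le (hM : 0 < M) (hσ : IsDensity σ) {t : ℝ}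
    (ht : 0 ≤ t) :
    (recordLaw G θ M σ).real {d | t ≤ expectation (rotHamiltonian G θ) σ - energyEstimate d} ≤
      Real.exp (-2 * M * t ^ 2 / Fintype.card V) := by
  have := fun p : V × Fin M =>
    isProbabilityMeasure_outcomeLaw (localTerm_isHermitian G θ p.1) hσ
  have hM' : (0 : ℝ) < M := by exact_mod_cast hM
  have h := pi_real_sum_integral_sub_ge_le
    (μ := fun p : V × Fin M =>
      outcomeLaw (localTerm G θ p.1) (localTerm_isHermitian G θ p.1) σ)
    (fun p => ae_outcomeLaw_mem measurableSet_Icc _ (eigenvalues_localTerm_mem_Icc G θ p.1))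
    (t := M * t) (by positivity)
  simp only [sum_sub_record hM hσ, mul_le_mul_iff_right₀ hM'] at h
  refine h.trans_eq (congrArg Real.exp ?_)
  rw [Fintype.card_prod, Fintype.card_fin, Nat.cast_mul]
  rw [show -2 * ((M : ℝ) * t) ^ 2 = (-2 * M * t ^ 2) * M by ring, mul_div_mul_right _ _ hM'.ne']

/-- Subadditivity alone is used, so neither event has to be measurable. -/
theorem one_sub_le_measureReal {Ω : Type*} [MeasurableSpace Ω] (μ : Measure Ω)
    [IsProbabilityMeasure μ] {good bad : Set Ω} {δ : ℝ} (h : ∀ ω, ω ∉ bad → ω ∈ good)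
    (hbad : μ.real bad ≤ δ) : 1 - δ ≤ μ.real good := by
  have huniv : good ∪ bad = Set.univ :=
    Set.eq_univ_of_forall fun ω => or_iff_not_imp_right.2 (h ω)
  have := measureReal_union_le (μ := μ) good bad
  rw [huniv, probReal_univ] at this
  linarith

/-- Since 16384 = 128², the exponent is at most -2Nr, which is below -r log 2. -/
theorem exp_sample_bound {N M r ε : ℝ} (hN : 1 ≤ N) (hε : 0 < ε) (hr : 0 < r)
    (hM : 16384 * (N ^ 2 * r / ε ^ 4) ≤ M) :
    Real.exp (-2 * M * (1 / 128 * ε ^ 2) ^ 2 / N) ≤ 2 ^ (-r) := by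
  rw [Real.rpow_def_of_pos two_pos]
  refine Real.exp_le_exp.2 ?_
  rw [div_le_iff₀ (by linarith)]
  have h1 : 16384 * (N ^ 2 * r) ≤ M * ε ^ 4 := by
    rwa [← mul_div_assoc, div_le_iff₀ (by positivity)] at hM
  have h2 : Real.log 2 ≤ 1 := Real.log_two_lt_d9.le.trans (by norm_num)
  have h3 : Real.log 2 * (r * N) ≤ 1 * (r * N) := by gcongr
  have h4 : r * N * 1 ≤ r * N * N := by gcongr
  nlinarith [show 0 ≤ N ^ 2 * r by positivity]

theorem sqrt_one_sub_sqrt_le {a : ℝ} (ha : 0 ≤ a) (ha1 : a ≤ 1) :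
    Real.sqrt (1 - Real.sqrt (1 - a ^ 2)) ≤ a := by
  rw [Real.sqrt_le_left ha, sub_le_comm]
  have h : 0 ≤ 1 - a ^ 2 := by nlinarith
  exact Real.le_sqrt_of_sq_le (by nlinarith)

theorem sqrt_one_sub_sq_le {a : ℝ} (ha : 0 ≤ a) (ha1 : a ≤ 1) :
    Real.sqrt (1 - a ^ 2) ≤ 1 - a ^ 2 / 2 :=
  (Real.sqrt_le_left (by nlinarith)).2 (by nlinarith [sq_nonneg (a ^ 2)])

theorem certification [Nonempty V] {ε r : ℝ} (hε : 0 < ε) (hε2 : ε ≤ 2) (hr : 0 < r)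
    (hM : 16384 * ((Fintype.card V : ℝ) ^ 2 * r / ε ^ 4) ≤ M) (hσ : IsDensity σ) {R : ℕ} {η : ℝ}
    (hη : 0 ≤ η) (hηε : η ≤ 1 / 4 * (ε / Fintype.card V)) {Λ : Module.End ℂ (Op V)}
    (hΛ : IsImperfection G R η Λ) :
    1 - (2 : ℝ) ^ (-r) ≤ (recordLaw G θ M σ).real
      {d | Accepts (1 / 4 * ε) (1 / 128 * ε ^ 2) d →
        ∑ x, |xProb (idealState G θ) x - xProb (Λ σ) x| ≤ ε} := by
  have := isProbabilityMeasure_recordLaw (G := G) (θ := θ) (M := M) hσ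
  have hN : (1 : ℝ) ≤ Fintype.card V := by exact_mod_cast Fintype.card_pos
  have hM0 : 0 < M := by
    have : (0 : ℝ) < M := lt_of_lt_of_le (by positivity) hM
    exact_mod_cast this
  refine one_sub_le_measureReal _ (fun d hd hacc => ?_)
    ((recordLaw_real_sub_energyEstimate_ge_le hM0 hσ (by positivity)).trans
      (exp_sample_bound hN hε hr hM))
  rw [Set.mem_ofPred_eq, not_le] at hd
  rw [Accepts, fidelityEstimate] at hacc
  -- The margin ε²/128 in the test absorbs the statistical error, so acceptance bounds the true
  -- fidelity.
  have hF : Real.sqrt (1 - (1 / 4 * ε) ^ 2) ≤ fidelity (idealVec G θ) σ := by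
    linarith [one_sub_expectation_le_fidelity G θ hσ]
  have hpure := sum_abs_xProb_pure_sub_le (idealVec_normalized G θ) hσ
  have hdist : Real.sqrt (1 - fidelity (idealVec G θ) σ) ≤ 1 / 4 * ε :=
    (Real.sqrt_le_sqrt (by linarith)).trans
      (sqrt_one_sub_sqrt_le (by positivity) (by linarith))
  have himp := hΛ.sum_abs_xProb_sub_le hη hσ
  have hηN : η * Fintype.card V ≤ 1 / 4 * ε := by
    calc η * Fintype.card V ≤ 1 / 4 * (ε / Fintype.card V) * Fintype.card V := by gcongr
      _ = 1 / 4 * ε := by field_simp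
  calc ∑ x, |xProb (idealState G θ) x - xProb (Λ σ) x|
      ≤ ∑ x, (|xProb (idealState G θ) x - xProb σ x| + |xProb (Λ σ) x - xProb σ x|) :=
        Finset.sum_le_sum fun x _ => by
          rw [abs_sub_comm (xProb (Λ σ) x)]; exact abs_sub_le _ _ _
    -- State preparation and measurement imperfections contribute ε/2 each.
    _ ≤ ε := by
        rw [Finset.sum_add_distrib, idealState]; linarith

theorem completeness [Nonempty V] {ε r : ℝ} (hε : 0 < ε) (hε2 : ε ≤ 2) (hr : 0 < r)
    (hM : 16384 * ((Fintype.card V : ℝ) ^ 2 * r / ε ^ 4) ≤ M) (hσ : IsDensity σ)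
    (hE : expectation (rotHamiltonian G θ) σ ≤ 1 / 128 * ε ^ 2) :
    1 - (2 : ℝ) ^ (-r) ≤ (recordLaw G θ M σ).real
      {d | Accepts (1 / 4 * ε) (1 / 128 * ε ^ 2) d} := by
  have := isProbabilityMeasure_recordLaw (G := G) (θ := θ) (M := M) hσ
  have hN : (1 : ℝ) ≤ Fintype.card V := by exact_mod_cast Fintype.card_pos
  have hM0 : 0 < M := by
    have : (0 : ℝ) < M := lt_of_lt_of_le (by positivity) hM
    exact_mod_cast this
  refine one_sub_le_measureReal _ (fun d hd => ?_)
    ((recordLaw_real_energyEstimate_sub_ge_le hM0 hσ (by positivity)).trans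
      (exp_sample_bound hN hε hr hM))
  rw [Set.mem_ofPred_eq, not_le] at hd
  rw [Set.mem_ofPred_eq, Accepts, fidelityEstimate]
  -- The square root leaves room ε²/32, that is 4 units of ε²/128; energy, fluctuation and test
  -- margin take one unit each.
  have := sqrt_one_sub_sq_le (a := 1 / 4 * ε) (by positivity) (by linarith)
  nlinarith

end Record

end BrickworkCert

end

theorem mainTheorem4 :
    (∀ (s m n : ℕ) (i : Fin m × Fin n), ((brickwork s m n).neighborSet i).ncard ≤ 3) ∧
    ∃ (cd cf cm ce C : ℝ), 0 < cd ∧ 0 < cf ∧ 0 < cm ∧ 0 < ce ∧ 0 < C ∧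
      ∀ (m n : ℕ), 0 < m → 0 < n →
      ∀ (G : SimpleGraph (Fin m × Fin n)), (∀ i, (G.neighborSet i).ncard ≤ 3) →
      ∀ (θ : Fin m × Fin n → ℝ),
        rotHamiltonian G θ = rotLayer θ * graphHamiltonian G * (rotLayer θ).conjTranspose ∧
        (∀ i, IsLocal 4 (localTerm G θ i)) ∧
        IsUniqueGroundState (rotHamiltonian G θ) 0 (idealVec G θ) ∧
        HasGap (rotHamiltonian G θ) 0 1 ∧
        ∀ (ε r : ℝ), 0 < ε → ε ≤ 2 → 0 < r →
        ∀ (M : ℕ), C * ((m : ℝ) ^ 2 * (n : ℝ) ^ 2 * r / ε ^ 4) ≤ (M : ℝ) →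
        ∀ (ρ' : Op (Fin m × Fin n)), IsDensity ρ' →
          (∀ (R : ℕ) (η : ℝ), 0 ≤ η → η ≤ cm * (ε / ((m : ℝ) * (n : ℝ))) →
            ∀ (Λ : Module.End ℂ (Op (Fin m × Fin n))), IsImperfection G R η Λ →
              1 - (2 : ℝ) ^ (-r) ≤ (recordLaw G θ M ρ').real
                {d | Accepts (cd * ε) (cf * ε ^ 2) d →
                  ∑ x, |xProb (idealState G θ) x - xProb (Λ ρ') x| ≤ ε}) ∧
          (expectation (rotHamiltonian G θ) ρ' ≤ ce * ε ^ 2 →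
            1 - (2 : ℝ) ^ (-r) ≤ (recordLaw G θ M ρ').real
              {d | Accepts (cd * ε) (cf * ε ^ 2) d}) := by
  refine ⟨ncard_neighborSet_brickwork_le, 1 / 4, 1 / 128, 1 / 4, 1 / 128, 16384, by norm_num,
    by norm_num, by norm_num, by norm_num, by norm_num, ?_⟩
  intro m n hm hn G hG θ
  have : NeZero m := ⟨hm.ne'⟩
  have : NeZero n := ⟨hn.ne'⟩
  have hcard : (Fintype.card (Fin m × Fin n) : ℝ) = m * n := by simp
  refine ⟨rotHamiltonian_eq G θ, fun i => isLocal_localTerm G θ (hG i),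
    isUniqueGroundState_idealVec G θ, hasGap_rotHamiltonian G θ, ?_⟩
  intro ε r hε hε2 hr M hM σ hσ
  -- The guarantees depend on the lattice only through the number of spins, mn.
  rw [← mul_pow, ← hcard] at hM
  refine ⟨fun R η hη hηε Λ hΛ => ?_, completeness hε hε2 hr hM hσ⟩
  rw [← hcard] at hηε
  exact certification hε hε2 hr hM hσ hη hηε hΛ
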